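/- For an endofunction $f$ of a finite set $X$, the state space of $f$ is the digraph with vertex set $X$ that has an edge from $x$ to $y$ if and only if $y=f(x)$. A (directed) $1$-tree is a weakly connected digraph in which each vertex has exactly one outgoing edge and which contains exactly one directed cycle, where loops count as cycles of length $1$. Let $\tau(m)$ denote the number of positive divisors of $m\in\mathbb{N}^+$. Theorem 5. Let $n=2^k\cdot p_1^{k_1}\cdots p_l^{k_l}$ be a positive integer, where $k,l\geq 0$, the $p_i$ are pairwise distinct odd primes, and $k_1,\ldots,k_l\geq 1$. Let $\delta_{[k\leq 2]}:=1$ if $k\leq 2$ and $\delta_{[k\leq 2]}:=0$ otherwise. Then the number of isomorphism types (as digraphs) of state spaces of endomorphisms of the group $\mathbb{Z}/n\mathbb{Z}$ is precisely $$\max\{2^{k\cdot\delta_{[k\leq 2]}},\,3k-3\}\cdot\prod_{i=1}^l k_i(\tau(p_i-1)+1).$$ Of these isomorphism types, precisely $$\max\{1,k\}\cdot\prod_{i=1}^l k_i$$ are $1$-trees, and precisely $$\max\{1,k,2k-3\}\cdot\prod_{i=1}^l k_i\,\tau(p_i-1)$$ are disjoint unions of directed cycles (of lengths $\geq 1$).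 -/

import Mathlib

namespace FinDynSys

universe u

/-- The state space of the endofunction `f` of `X`: the digraph with vertex set `X` and an edge
from `x` to `y` if and only if `y = f x`. -/
def stateSpace {X : Type u} (f : X → X) : Digraph X where
  Adj x y := y = f x

/-- Two digraphs are isomorphic if there is a bijection of the vertex sets that preserves and
reflects the edge relation. -/
def Isomorphic {V W : Type*} (G : Digraph V) (H : Digraph W) : Prop :=
  Nonempty (G.Adj ≃r H.Adj)

/-- Isomorphism as an equivalence relation on the digraphs with a fixed vertex set. -/
def isoSetoid (V : Type u) : Setoid (Digraph V) where
  r G H := Isomorphic G H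
  iseqv :=
    { refl := fun G => ⟨RelIso.refl G.Adj⟩
      symm := fun ⟨e⟩ => ⟨e.symm⟩
      trans := fun ⟨e⟩ ⟨e'⟩ => ⟨e.trans e'⟩ }

/-- The isomorphism type of a digraph among the digraphs with the same vertex set. -/
def isoType {V : Type u} (G : Digraph V) : Quotient (isoSetoid V) :=
  Quotient.mk (isoSetoid V) G

/-- The directed cycle of length `m` for `m ≥ 1`; it is a loop for `m = 1`. -/
def directedCycle (m : ℕ) : Digraph (ZMod m) where
  Adj a b := b = a + 1

/-- The disjoint union of a family of digraphs. -/
def disjointUnion {ι : Type u} {V : ι → Type*} (G : ∀ i, Digraph (V i)) :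
    Digraph (Σ i, V i) where
  Adj x y := ∃ (i : ι) (a b : V i), x = ⟨i, a⟩ ∧ y = ⟨i, b⟩ ∧ (G i).Adj a b

/-- `G` is (isomorphic to) a disjoint union of directed cycles. -/
def IsDisjointUnionOfCycles {V : Type u} (G : Digraph V) : Prop :=
  ∃ (ι : Type u) (m : ι → ℕ), (∀ i, 0 < m i) ∧
    Isomorphic G (disjointUnion fun i => directedCycle (m i))

/-- `E` is the edge set of a directed cycle contained in `G`. -/
def IsCycleIn {V : Type u} (G : Digraph V) (E : Set (V × V)) : Prop :=
  ∃ (m : ℕ) (c : ZMod m → V), 0 < m ∧ Function.Injective c ∧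
    (∀ a b, (directedCycle m).Adj a b → G.Adj (c a) (c b)) ∧
    E = {x | ∃ a b, (directedCycle m).Adj a b ∧ x = (c a, c b)}

/-- `G` is a directed `1`-tree: it is weakly connected, every vertex has exactly one outgoing edge,
and there is exactly one directed cycle (possibly a loop). -/
def IsOneTree {V : Type u} (G : Digraph V) : Prop :=
  G.toSimpleGraphInclusive.Connected ∧ (∀ x, ∃! y, G.Adj x y) ∧ ∃! E, IsCycleIn G E

/-- The set of isomorphism types of state spaces of endomorphisms of the additive group `A` that
satisfy `P`. -/
def endStateTypes (A : Type u) [AddGroup A] (P : Digraph A → Prop) :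
    Set (Quotient (isoSetoid A)) :=
  {t | ∃ φ : A →+ A, P (stateSpace φ) ∧ isoType (stateSpace φ) = t}

end FinDynSys

/-!
Every endomorphism of `ℤ/n` is multiplication by some `a`, and the count rests on a numerical
classification of the state spaces of multiplications.

Two numbers are visible in the state space: the size of the range, which is the additive order
of `a`, and for each `t` the number of fixed points of the `t`-th iterate, which is `n` divided by
the additive order of `a ^ t - 1`. Under `ℤ/n ≅ ∏ ℤ/q_i` with prime powers `q_i` these numbers are
products of divisors of the pairwise coprime `q_i`, so that they determine the corresponding numbers
of all components (`mulType_eq_iff_forall`).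

Modulo a prime power `p ^ e` they determine the state space (`mulType_eq_of_addOrderOf_eq`). An
element is a unit or nilpotent. A nilpotent `p ^ j * u` has the state space of `p ^ j`, by an
explicit conjugation (`mulType_prime_pow_mul_unit`). For units `a` and `b`, equal additive orders of
`a ^ t - 1` and `b ^ t - 1` in the cyclic group `ℤ/p^e` force equal annihilators, so that all powers
of the two permutations have the same fixed points; then they have equally many cycles of each
length and are conjugate (`exists_semiconj_of_iterate_fixed_iff`).

Consequently the number of types modulo `n` is the product of the numbers modulo the `q_i`, also for
nilpotent `a` (the `1`-trees, `isOneTree_mul_iff`) and for units (the unions of cycles,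
`isDisjointUnionOfCycles_mul_iff`). Modulo `p ^ e` with `e ≥ 1` there are `e` nilpotent types. For
odd `p` the unit group is cyclic and the type of a unit amounts to its order, a divisor of
`(p - 1) * p ^ (e - 1)` (`ncard_mulType_isUnit_of_ne_two`). Modulo `2 ^ k`, lifting the exponent
shows that the type of a unit `u` amounts to the additive orders of `u - 1` and `u ^ 2 - 1`, whose
possible values are listed by writing `u` as `±1` plus a multiple of `4`
(`ncard_mulType_isUnit_two_pow`).
-/

namespace FinDynSys

open Function

universe v w

/-! ### Isomorphisms of state spaces -/

theorem isomorphic_stateSpace_iff {X Y : Type*} {f : X → X} {g : Y → Y} :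
    Isomorphic (stateSpace f) (stateSpace g) ↔ ∃ e : X ≃ Y, Semiconj e f g := by
  constructor
  · rintro ⟨e⟩
    exact ⟨e.toEquiv, fun x => (e.map_rel_iff (a := x) (b := f x)).2 rfl⟩
  · rintro ⟨e, he⟩
    refine ⟨⟨e, ?_⟩⟩
    intro x y
    change e y = g (e x) ↔ y = f x
    rw [← he x, e.apply_eq_iff_eq]

theorem card_range_eq_of_semiconj {X Y : Type*} {f : X → X} {g : Y → Y} (e : X ≃ Y)
    (h : Semiconj e f g) : Nat.card (Set.range f) = Nat.card (Set.range g) := by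
  refine Nat.card_congr (e.subtypeEquiv fun y => ?_)
  constructor
  · rintro ⟨x, rfl⟩
    exact ⟨e x, (h x).symm⟩
  · rintro ⟨x, hx⟩
    exact ⟨e.symm x, e.injective (by rw [h, e.apply_symm_apply, hx])⟩

theorem card_fixedPoints_iterate_eq_of_semiconj {X Y : Type*} {f : X → X} {g : Y → Y} (e : X ≃ Y)
    (h : Semiconj e f g) (t : ℕ) :
    Nat.card {x // f^[t] x = x} = Nat.card {y // g^[t] y = y} :=
  Nat.card_congr (e.subtypeEquiv fun x => by
    rw [← (h.iterate_right t) x, e.apply_eq_iff_eq])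

/-! ### Permutations and their cycles -/

/-- The successor map on a disjoint union of cycles of lengths `m i`; its state space is the
disjoint union of the directed cycles of lengths `m i`. -/
def rotation {ι : Type v} (m : ι → ℕ) (z : Σ i, ZMod (m i)) : Σ i, ZMod (m i) :=
  ⟨z.1, z.2 + 1⟩

theorem disjointUnion_directedCycle {ι : Type v} (m : ι → ℕ) :
    disjointUnion (fun i => directedCycle (m i)) = stateSpace (rotation m) := by
  ext ⟨i, a⟩ ⟨j, b⟩
  constructor
  · rintro ⟨k, c, d, h₁, h₂, h₃⟩
    cases h₁
    cases h₂
    cases h₃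
    rfl
  · intro h
    cases h
    exact ⟨i, a, a + 1, rfl, rfl, rfl⟩

theorem rotation_iterate {ι : Type v} (m : ι → ℕ) (t : ℕ) (z : Σ i, ZMod (m i)) :
    (rotation m)^[t] z = ⟨z.1, z.2 + t⟩ := by
  induction t with
  | zero => simp
  | succ t ih => rw [iterate_succ_apply', ih, rotation]; simp [add_assoc]

theorem minimalPeriod_rotation {ι : Type v} (m : ι → ℕ) (z : Σ i, ZMod (m i)) :
    minimalPeriod (rotation m) z = m z.1 := by
  refine Nat.dvd_antisymm ?_ ?_
  · rw [← isPeriodicPt_iff_minimalPeriod_dvd, IsPeriodicPt, IsFixedPt, rotation_iterate]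
    simp
  · have h := isPeriodicPt_minimalPeriod (rotation m) z
    rw [IsPeriodicPt, IsFixedPt, rotation_iterate] at h
    have h2 : z.2 + ((minimalPeriod (rotation m) z : ℕ) : ZMod (m z.1)) = z.2 := by
      obtain ⟨i, a⟩ := z
      simpa using h
    rwa [add_eq_left, ZMod.natCast_eq_zero_iff] at h2

/-- A permutation of a finite set is conjugate to a rotation of a disjoint union of cycles. -/
theorem exists_semiconj_rotation {X : Type v} [Finite X] (f : Equiv.Perm X) :
    ∃ (ι : Type v) (_ : Finite ι) (m : ι → ℕ), (∀ i, 0 < m i) ∧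
      ∃ e : X ≃ Σ i, ZMod (m i), Semiconj e f (rotation m) := by
  let Ω := MulAction.orbitRel.Quotient (Subgroup.zpowers f) X
  let m : Ω → ℕ := fun ω => minimalPeriod (f • ·) ω.out
  let e : X ≃ Σ ω : Ω, ZMod (m ω) :=
    (MulAction.selfEquivSigmaOrbits (Subgroup.zpowers f) X).trans
      (Equiv.sigmaCongrRight fun ω => MulAction.orbitZPowersEquiv f ω.out)
  have key : ∀ (ω : Ω) (k : ℤ), e.symm ⟨ω, (k : ZMod (m ω))⟩ = (f ^ k) ω.out := by
    intro ω k
    change (((MulAction.orbitZPowersEquiv f ω.out).symm (k : ZMod (m ω)) :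
      MulAction.orbit (Subgroup.zpowers f) ω.out) : X) = _
    rw [MulAction.orbitZPowersEquiv_symm_apply']
    rfl
  refine ⟨Ω, inferInstance, m, fun ω => ?_, e, fun x => ?_⟩
  · exact minimalPeriod_pos_of_mem_periodicPts
      (Function.Injective.mem_periodicPts f.injective ω.out)
  · obtain ⟨⟨ω, a⟩, rfl⟩ := e.symm.surjective x
    obtain ⟨k, rfl⟩ := ZMod.intCast_surjective a
    have h : rotation m ⟨ω, (k : ZMod (m ω))⟩ = ⟨ω, ((1 + k : ℤ) : ZMod (m ω))⟩ := by
      rw [rotation]; push_cast; rw [add_comm]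
    rw [e.apply_symm_apply, h, ← e.apply_symm_apply ⟨ω, ((1 + k : ℤ) : ZMod (m ω))⟩, key, key,
      zpow_one_add, Equiv.Perm.mul_apply]

/-- The points of exact period `d` lie on the cycles of length `d`, and there are `d` of them on
each such cycle. -/
theorem card_minimalPeriod_eq {X : Type v} {ι : Type w} [Finite ι] (f : X → X) (m : ι → ℕ)
    (e : X ≃ Σ i, ZMod (m i)) (he : Semiconj e f (rotation m)) (d : ℕ) :
    Nat.card {x // minimalPeriod f x = d} = Nat.card {i // m i = d} * d := by
  have hper : ∀ x, minimalPeriod f x = m (e x).1 := by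
    intro x
    rw [← minimalPeriod_rotation m (e x)]
    refine minimalPeriod_eq_minimalPeriod_iff.2 fun t => ?_
    rw [IsPeriodicPt, IsPeriodicPt, IsFixedPt, IsFixedPt, ← (he.iterate_right t) x,
      e.apply_eq_iff_eq]
  have E : {x // minimalPeriod f x = d} ≃ {i // m i = d} × ZMod d :=
    (e.subtypeEquiv fun x => by rw [hper]).trans <|
      (Equiv.subtypeSigmaEquiv (fun i => ZMod (m i)) fun i => m i = d).trans <|
      (Equiv.sigmaCongrRight fun i => (ZMod.ringEquivCongr i.2).toEquiv).trans <|
      Equiv.sigmaEquivProd _ _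
  rw [Nat.card_congr E, Nat.card_prod, Nat.card_zmod]

/-- Two permutations of a finite set are conjugate as soon as each power of the one has the same
fixed points as the same power of the other: they then have equally many cycles of each length. -/
theorem exists_semiconj_of_iterate_fixed_iff {X : Type v} [Finite X] (f g : Equiv.Perm X)
    (h : ∀ t x, f^[t] x = x ↔ g^[t] x = x) : ∃ e : X ≃ X, Semiconj e f g := by
  obtain ⟨ι, _, m, hm, e, he⟩ := exists_semiconj_rotation f
  obtain ⟨κ, _, n, hn, e', he'⟩ := exists_semiconj_rotation g
  have hper : ∀ x, minimalPeriod f x = minimalPeriod g x := fun x =>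
    minimalPeriod_eq_minimalPeriod_iff.2 fun t => h t x
  have hcard : ∀ d, Nonempty ({i // m i = d} ≃ {j // n j = d}) := by
    intro d
    rcases Nat.eq_zero_or_pos d with rfl | hd
    · have : IsEmpty {i // m i = 0} := ⟨fun i => (hm i.1).ne' i.2⟩
      have : IsEmpty {j // n j = 0} := ⟨fun j => (hn j.1).ne' j.2⟩
      exact ⟨Equiv.equivOfIsEmpty _ _⟩
    · refine Finite.card_eq.1 (Nat.eq_of_mul_eq_mul_right hd ?_)
      rw [← card_minimalPeriod_eq f m e he, ← card_minimalPeriod_eq g n e' he']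
      simp only [hper]
  let σ : ι ≃ κ := (Equiv.sigmaFiberEquiv m).symm.trans
    ((Equiv.sigmaCongrRight fun d => (hcard d).some).trans (Equiv.sigmaFiberEquiv n))
  have hσ : ∀ i, n (σ i) = m i := fun i => ((hcard (m i)).some ⟨i, rfl⟩).2
  let τ : (Σ i, ZMod (m i)) ≃ Σ j, ZMod (n j) :=
    Equiv.sigmaCongr σ fun i => (ZMod.ringEquivCongr (hσ i).symm).toEquiv
  have hτ : Semiconj τ (rotation m) (rotation n) := by
    have happ : ∀ z, τ z = ⟨σ z.1, ZMod.ringEquivCongr (hσ z.1).symm z.2⟩ := fun _ => rfl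
    intro z
    rw [happ, happ, rotation, rotation, map_add, map_one]
  refine ⟨(e.trans τ).trans e'.symm, fun x => ?_⟩
  have h₁ : τ (e (f x)) = rotation n (τ (e x)) := by rw [he, hτ]
  have h₂ := he' (e'.symm (τ (e x)))
  rw [e'.apply_symm_apply] at h₂
  simp only [Equiv.trans_apply]
  rw [h₁, ← h₂, e'.symm_apply_apply]

/-! ### State spaces of multiplications: trees and unions of cycles -/

/-- The isomorphism type of the state space of multiplication by `a`. -/
def mulType {R : Type*} [Mul R] (a : R) : Quotient (isoSetoid R) :=
  isoType (stateSpace (a * ·))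

theorem mulType_eq_iff {R : Type*} [Mul R] {a b : R} :
    mulType a = mulType b ↔ ∃ e : R ≃ R, Semiconj e (a * ·) (b * ·) := by
  rw [← isomorphic_stateSpace_iff]
  exact Quotient.eq (r := isoSetoid R)

/-- A periodic point lies on a directed cycle. -/
theorem exists_isCycleIn_of_periodic {X : Type v} (f : X → X) {x : X} (hx : x ∈ periodicPts f) :
    ∃ E, IsCycleIn (stateSpace f) E ∧ (x, f x) ∈ E := by
  set m := minimalPeriod f x with hm
  have hm0 : 0 < m := minimalPeriod_pos_of_mem_periodicPts hx
  have : NeZero m := ⟨hm0.ne'⟩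
  let c : ZMod m → X := fun a => f^[a.val] x
  have hc : ∀ a, c (a + 1) = f (c a) := by
    intro a
    change f^[(a + 1).val] x = f (f^[a.val] x)
    rw [← iterate_succ_apply' f, ZMod.val_add, ZMod.val_one_eq_one_mod, Nat.add_mod_mod]
    exact iterate_mod_minimalPeriod_eq
  refine ⟨_, ⟨m, c, hm0, ?_, ?_, rfl⟩, 0, 0 + 1, rfl, ?_⟩
  · intro a b hab
    exact ZMod.val_injective m
      (iterate_injOn_Iio_minimalPeriod (ZMod.val_lt a) (ZMod.val_lt b) hab)
  · rintro a b rfl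
    exact hc a
  · rw [hc]
    simp [c]

/-- Multiplication by `a` is a `1`-tree exactly when `a` is nilpotent: otherwise some nonzero power
of `a` is periodic and its cycle avoids the loop at `0`. -/
theorem isOneTree_mul_iff {R : Type v} [CommRing R] [Finite R] (a : R) :
    IsOneTree (stateSpace (a * ·)) ↔ IsNilpotent a := by
  constructor
  · rintro ⟨-, -, E, -, hE⟩
    by_contra hnil
    obtain ⟨i, j, hij, h⟩ := Finite.exists_ne_map_eq_of_infinite (fun i : ℕ => a ^ i)
    wlog hlt : i < j generalizing i j
    · exact this j i hij.symm h.symm (by omega)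
    obtain ⟨t, rfl⟩ := Nat.exists_eq_add_of_lt hlt
    have hi : a ^ i ∈ periodicPts (a * ·) := by
      refine ⟨t + 1, by omega, ?_⟩
      rw [IsPeriodicPt, IsFixedPt, mul_left_iterate]
      change a ^ (t + 1) * a ^ i = a ^ i
      rw [← pow_add]
      exact (h.trans (congrArg (a ^ ·) (by omega))).symm
    have h0 : (0 : R) ∈ periodicPts (a * ·) := ⟨1, one_pos, mul_zero a⟩
    obtain ⟨E₁, h₁, hm₁⟩ := exists_isCycleIn_of_periodic _ hi
    obtain ⟨E₂, ⟨m, c, hm, hinj, hc, rfl⟩, z, w, hzw, h₂⟩ := exists_isCycleIn_of_periodic _ h0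
    have h₃ := (hE _ h₁).trans (hE _ ⟨m, c, hm, hinj, hc, rfl⟩).symm
    rw [h₃] at hm₁
    obtain ⟨y, y', hy, hyc⟩ := hm₁
    -- By uniqueness `a ^ i` lies on the cycle through `0`, and from `0` only `0` is reached.
    have hstep : ∀ u, c (u + 1) = a * c u := fun u => hc u (u + 1) rfl
    have hz : c z = 0 := (congrArg Prod.fst h₂).symm
    have hadd : ∀ n : ℕ, c (z + n) = 0 := by
      intro n
      induction n with
      | zero => simpa using hz
      | succ n ih => rw [Nat.cast_succ, ← add_assoc, hstep, ih, mul_zero]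
    have : NeZero m := ⟨hm.ne'⟩
    refine hnil ⟨i, ?_⟩
    have h₄ := hadd (y - z).val
    rw [ZMod.natCast_zmod_val, add_sub_cancel] at h₄
    exact (congrArg Prod.fst hyc).trans h₄
  · rintro ⟨N, hN⟩
    have hiter : ∀ x, (a * ·)^[N] x = 0 := fun x => by simp [mul_left_iterate, hN]
    refine ⟨?_, fun x => ⟨a * x, rfl, fun y hy => hy⟩, {(0, 0)}, ?_, ?_⟩
    · have hstep : ∀ x,
          (stateSpace (a * ·)).toSimpleGraphInclusive.Reachable x (a * x) := by
        intro x
        by_cases hx : x = a * x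
        · rw [← hx]
        · exact SimpleGraph.Adj.reachable ⟨hx, Or.inl rfl⟩
      have hreach : ∀ n x,
          (stateSpace (a * ·)).toSimpleGraphInclusive.Reachable x ((a * ·)^[n] x) := by
        intro n
        induction n with
        | zero => exact fun x => SimpleGraph.Reachable.refl x
        | succ n ih => exact fun x => (hstep x).trans (ih (a * x))
      have : Nonempty R := ⟨0⟩
      refine ⟨fun x y => ?_⟩
      have hx := hreach N x
      have hy := hreach N y
      rw [hiter] at hx hy
      exact hx.trans hy.symm
    · refine ⟨1, fun _ => 0, one_pos, fun x y _ => Subsingleton.elim x y,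
        fun _ _ _ => (mul_zero a).symm, ?_⟩
      ext x
      constructor
      · rintro rfl
        exact ⟨0, 0 + 1, rfl, rfl⟩
      · rintro ⟨_, _, _, rfl⟩
        rfl
    · rintro E ⟨m, c, hm, hinj, hc, rfl⟩
      have hadd : ∀ (n : ℕ) (z : ZMod m), c (z + n) = a ^ n * c z := by
        intro n
        induction n with
        | zero => simp
        | succ n ih =>
          intro z
          rw [Nat.cast_succ, ← add_assoc, hc (z + n) _ rfl, ih, pow_succ', mul_assoc]
      have hzero : ∀ z, c z = 0 := by
        intro z
        have h := hadd N (z - N)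
        rwa [sub_add_cancel, hN, zero_mul] at h
      ext x
      constructor
      · rintro ⟨y, y', -, rfl⟩
        rw [hzero, hzero]
        rfl
      · rintro rfl
        exact ⟨0, 0 + 1, rfl, by rw [hzero, hzero]⟩

theorem isDisjointUnionOfCycles_mul_iff {R : Type v} [CommRing R] [Finite R] (a : R) :
    IsDisjointUnionOfCycles (stateSpace (a * ·)) ↔ IsUnit a := by
  constructor
  · rintro ⟨ι, m, hm, h⟩
    rw [disjointUnion_directedCycle, isomorphic_stateSpace_iff] at h
    obtain ⟨e, he⟩ := h
    obtain ⟨z, hz⟩ : ∃ z, rotation m z = e 1 := ⟨⟨(e 1).1, (e 1).2 - 1⟩, by simp [rotation]⟩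
    have h := he (e.symm z)
    rw [e.apply_symm_apply, hz] at h
    exact .of_mul_eq_one _ (e.injective h)
  · rintro ⟨u, rfl⟩
    obtain ⟨ι, -, m, hm, e, he⟩ := exists_semiconj_rotation (Units.mulLeft u)
    exact ⟨ι, m, hm, by
      rw [disjointUnion_directedCycle, isomorphic_stateSpace_iff]; exact ⟨e, he⟩⟩

/-! ### Invariants of multiplications modulo `n` -/

@[to_additive]
theorem zpowers_eq_of_orderOf_eq {G : Type*} [Group G] [IsCyclic G] [Finite G] {x y : G}
    (h : orderOf x = orderOf y) : Subgroup.zpowers x = Subgroup.zpowers y := by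
  classical
  have := Fintype.ofFinite G
  have key : ∀ z : G, orderOf z = orderOf x →
      (Subgroup.zpowers z : Set G) = {w | w ^ orderOf x = 1} := by
    intro z hz
    refine Set.eq_of_subset_of_ncard_le ?_ ?_ (Set.toFinite _)
    · rintro _ ⟨k, rfl⟩
      rw [Set.mem_ofPred_eq, ← hz, ← zpow_natCast, zpow_comm, zpow_natCast, pow_orderOf_eq_one,
        one_zpow]
    · rw [Set.ncard_eq_toFinset_card']
      simp only [Set.toFinset_ofPred]
      refine (IsCyclic.card_pow_eq_one_le (orderOf_pos x)).trans ?_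
      rw [← hz, ← Nat.card_zpowers, ← Nat.card_coe_set_eq]
      rfl
  exact SetLike.coe_injective ((key x rfl).trans (key y h.symm).symm)

section ZModInvariants

variable {n : ℕ} [NeZero n]

theorem card_range_mul (a : ZMod n) : Nat.card (Set.range (a * ·)) = addOrderOf a := by
  rw [← Nat.card_zmultiples]
  congr 2
  ext x
  constructor
  · rintro ⟨y, rfl⟩
    exact ⟨(y.val : ℤ), by simp [mul_comm]⟩
  · rintro ⟨k, rfl⟩
    exact ⟨k, by simp [mul_comm]⟩

theorem card_mul_eq_zero_mul_addOrderOf (c : ZMod n) :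
    Nat.card {x : ZMod n // c * x = 0} * addOrderOf c = n := by
  have h := AddSubgroup.card_mul_index (AddMonoidHom.mulLeft c).ker
  rw [AddSubgroup.index_ker, Nat.card_zmod] at h
  rw [← card_range_mul c]
  exact h

theorem card_fixedPoints_iterate_mul (a : ZMod n) (t : ℕ) :
    Nat.card {x // (a * ·)^[t] x = x} * addOrderOf (a ^ t - 1) = n := by
  have h := card_mul_eq_zero_mul_addOrderOf (a ^ t - 1)
  simpa only [mul_left_iterate, sub_mul, one_mul, sub_eq_zero] using h

theorem addOrderOf_eq_of_mulType_eq {a b : ZMod n} (h : mulType a = mulType b) :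
    addOrderOf a = addOrderOf b := by
  obtain ⟨e, he⟩ := mulType_eq_iff.1 h
  rw [← card_range_mul, ← card_range_mul, card_range_eq_of_semiconj e he]

theorem addOrderOf_pow_sub_one_eq_of_card_eq {a b : ZMod n} {t : ℕ}
    (h : Nat.card {x // (a * ·)^[t] x = x} = Nat.card {x // (b * ·)^[t] x = x}) :
    addOrderOf (a ^ t - 1) = addOrderOf (b ^ t - 1) := by
  have ha := card_fixedPoints_iterate_mul a t
  rw [h] at ha
  refine Nat.eq_of_mul_eq_mul_left ?_ (ha.trans (card_fixedPoints_iterate_mul b t).symm)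
  rw [Nat.pos_iff_ne_zero]
  intro h0
  rw [h0, zero_mul] at ha
  exact NeZero.ne n ha.symm

theorem addOrderOf_pow_sub_one_eq_of_mulType_eq {a b : ZMod n} (h : mulType a = mulType b)
    (t : ℕ) : addOrderOf (a ^ t - 1) = addOrderOf (b ^ t - 1) := by
  obtain ⟨e, he⟩ := mulType_eq_iff.1 h
  exact addOrderOf_pow_sub_one_eq_of_card_eq (card_fixedPoints_iterate_eq_of_semiconj e he t)

/-- Elements of the same additive order generate the same ideal, hence have the same annihilator. -/
theorem mul_eq_zero_iff_of_addOrderOf_eq {c d : ZMod n} (h : addOrderOf c = addOrderOf d)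
    (x : ZMod n) : c * x = 0 ↔ d * x = 0 := by
  have key : ∀ {c d : ZMod n}, addOrderOf c = addOrderOf d → c * x = 0 → d * x = 0 := by
    intro c d h hc
    have hd : d ∈ AddSubgroup.zmultiples c := by
      rw [zmultiples_eq_of_addOrderOf_eq h]
      exact AddSubgroup.mem_zmultiples d
    obtain ⟨k, rfl⟩ := hd
    simp [mul_assoc, hc]
  exact ⟨key h, key h.symm⟩

theorem mulType_eq_of_units (a b : (ZMod n)ˣ)
    (h : ∀ (t : ℕ) (x : ZMod n), ((a : ZMod n) ^ t - 1) * x = 0 ↔ ((b : ZMod n) ^ t - 1) * x = 0) :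
    mulType (a : ZMod n) = mulType (b : ZMod n) := by
  rw [mulType_eq_iff]
  refine exists_semiconj_of_iterate_fixed_iff a.mulLeft b.mulLeft fun t x => ?_
  have key : ∀ u : (ZMod n)ˣ, u.mulLeft^[t] x = x ↔ ((u : ZMod n) ^ t - 1) * x = 0 := by
    intro u
    rw [Units.mulLeft_apply, mul_left_iterate, sub_mul, one_mul, sub_eq_zero]
  rw [key, key, h]

end ZModInvariants

/-! ### Prime powers -/

theorem isNilpotent_natCast_pow_mul {p e i : ℕ} (hi : i ≠ 0) (x : ZMod (p ^ e)) :
    IsNilpotent ((p : ZMod (p ^ e)) ^ i * x) := by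
  refine (Commute.all _ _).isNilpotent_mul_right ?_
  refine ⟨e, ?_⟩
  rw [← pow_mul, mul_comm, pow_mul, ← Nat.cast_pow, ZMod.natCast_self, zero_pow hi]

section PrimePower

variable {p : ℕ} [Fact p.Prime] {e : ℕ}

theorem exists_eq_prime_pow_mul_unit (x : ZMod (p ^ e)) :
    ∃ i ≤ e, ∃ u : (ZMod (p ^ e))ˣ, x = (p : ZMod (p ^ e)) ^ i * u := by
  have hp : p.Prime := Fact.out
  by_cases hx : x = 0
  · exact ⟨e, le_rfl, 1, by rw [hx, ← Nat.cast_pow, ZMod.natCast_self, zero_mul]⟩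
  have h0 : x.val ≠ 0 := by rwa [Ne, ZMod.val_eq_zero]
  obtain ⟨i, m, hm, h⟩ := Nat.exists_eq_pow_mul_and_not_dvd h0 p hp.ne_one
  refine ⟨i, ?_, ZMod.unitOfCoprime m
    (Nat.Coprime.pow_right e ((Nat.Prime.coprime_iff_not_dvd hp).2 hm).symm), ?_⟩
  · by_contra! hi
    refine h0 (Nat.eq_zero_of_dvd_of_lt ?_ (ZMod.val_lt x))
    exact h ▸ (pow_dvd_pow p hi.le).mul_right m
  · rw [ZMod.coe_unitOfCoprime, ← Nat.cast_pow, ← Nat.cast_mul, ← h, ZMod.natCast_zmod_val]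

theorem addOrderOf_prime_pow_mul_unit (i : ℕ) (u : (ZMod (p ^ e))ˣ) :
    addOrderOf ((p : ZMod (p ^ e)) ^ i * u) = p ^ (e - i) := by
  have hp : p.Prime := Fact.out
  have h := addOrderOf_injective (AddMonoidHom.mulRight (u : ZMod (p ^ e)))
    (fun x y hxy => u.isUnit.mul_left_injective hxy) ((p : ZMod (p ^ e)) ^ i)
  rw [AddMonoidHom.coe_mulRight] at h
  rw [h, ← Nat.cast_pow, ZMod.addOrderOf_coe _ (NeZero.ne _)]
  rcases le_total i e with hi | hi
  · rw [Nat.gcd_eq_right (pow_dvd_pow p hi), Nat.pow_div hi hp.pos]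
  · rw [Nat.gcd_eq_left (pow_dvd_pow p hi), Nat.sub_eq_zero_of_le hi, pow_zero,
      Nat.div_self (pow_pos hp.pos e)]

/-- The `p`-adic valuation on `ℤ/p^e`, with the value `e` at `0`. -/
theorem exists_valuation : ∃ v : ZMod (p ^ e) → ℕ, ∀ i ≤ e, ∀ u : (ZMod (p ^ e))ˣ,
    v ((p : ZMod (p ^ e)) ^ i * u) = i := by
  refine ⟨fun x => e - Nat.log p (addOrderOf x), fun i hi u => ?_⟩
  have hp : p.Prime := Fact.out
  beta_reduce
  rw [addOrderOf_prime_pow_mul_unit, Nat.log_pow hp.one_lt]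
  omega

/-- Multiplication by a nilpotent element `p ^ j * u` has the same state space as multiplication
by `p ^ j`: the conjugation multiplies an element of valuation `s` by `u ^ (-⌊s / j⌋)`. -/
theorem mulType_prime_pow_mul_unit {j : ℕ} (hj : j ≠ 0) (u : (ZMod (p ^ e))ˣ) :
    mulType ((p : ZMod (p ^ e)) ^ j * u) = mulType ((p : ZMod (p ^ e)) ^ j) := by
  obtain ⟨v, hv⟩ := exists_valuation (p := p) (e := e)
  have hvu : ∀ (w : (ZMod (p ^ e))ˣ) x, v (w * x) = v x := by
    intro w x
    obtain ⟨i, hi, z, rfl⟩ := exists_eq_prime_pow_mul_unit x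
    rw [mul_left_comm, ← Units.val_mul, hv i hi, hv i hi]
  rw [mulType_eq_iff]
  let h : ZMod (p ^ e) ≃ ZMod (p ^ e) :=
    { toFun := fun x => ((u⁻¹ ^ (v x / j) : (ZMod (p ^ e))ˣ) : ZMod (p ^ e)) * x
      invFun := fun x => ((u ^ (v x / j) : (ZMod (p ^ e))ˣ) : ZMod (p ^ e)) * x
      left_inv := fun x => by
        simp only
        rw [hvu, ← mul_assoc, ← Units.val_mul, inv_pow, mul_inv_cancel, Units.val_one, one_mul]
      right_inv := fun x => by
        simp only
        rw [hvu, ← mul_assoc, ← Units.val_mul, inv_pow, inv_mul_cancel, Units.val_one, one_mul] }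
  refine ⟨h, fun x => ?_⟩
  change ((u⁻¹ ^ (v ((p : ZMod (p ^ e)) ^ j * u * x) / j) : (ZMod (p ^ e))ˣ) : ZMod (p ^ e)) *
    ((p : ZMod (p ^ e)) ^ j * u * x) =
    (p : ZMod (p ^ e)) ^ j * (((u⁻¹ ^ (v x / j) : (ZMod (p ^ e))ˣ) : ZMod (p ^ e)) * x)
  obtain ⟨i, hi, z, rfl⟩ := exists_eq_prime_pow_mul_unit x
  have hx : (p : ZMod (p ^ e)) ^ j * u * ((p : ZMod (p ^ e)) ^ i * z) =
      (p : ZMod (p ^ e)) ^ (i + j) * (u * z : (ZMod (p ^ e))ˣ) := by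
    rw [Units.val_mul, pow_add]; ring
  rcases le_total e (i + j) with hij | hij
  · -- Both sides vanish.
    have h0 : (p : ZMod (p ^ e)) ^ (i + j) = 0 := by
      rw [← Nat.cast_pow, ZMod.natCast_eq_zero_iff]
      exact pow_dvd_pow p hij
    rw [hx, h0, zero_mul, mul_zero, mul_left_comm, ← mul_assoc (_ ^ j), ← pow_add, add_comm j, h0,
      zero_mul, mul_zero]
  · rw [hx, hv _ hij, hv _ hi, Nat.add_div_right _ (Nat.pos_of_ne_zero hj),
      pow_succ, Units.val_mul, Units.val_mul, pow_add]
    linear_combination (p : ZMod (p ^ e)) ^ i * (p : ZMod (p ^ e)) ^ j * z *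
      ((u⁻¹ ^ (i / j) : (ZMod (p ^ e))ˣ) : ZMod (p ^ e)) * u.inv_mul

/-- Modulo a prime power the isomorphism type of multiplication by `a` is determined by the
additive orders of `a` (the size of its range) and of all the `a ^ t - 1` (the numbers of fixed
points of its iterates). -/
theorem mulType_eq_of_addOrderOf_eq {a b : ZMod (p ^ e)} (h : addOrderOf a = addOrderOf b)
    (ht : ∀ t : ℕ, addOrderOf (a ^ t - 1) = addOrderOf (b ^ t - 1)) : mulType a = mulType b := by
  have hp : p.Prime := Fact.out
  obtain ⟨i, hi, u, rfl⟩ := exists_eq_prime_pow_mul_unit a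
  obtain ⟨j, hj, w, rfl⟩ := exists_eq_prime_pow_mul_unit b
  rw [addOrderOf_prime_pow_mul_unit, addOrderOf_prime_pow_mul_unit] at h
  have hij : i = j := by
    have := Nat.pow_right_injective hp.two_le h
    omega
  subst hij
  rcases eq_or_ne i 0 with rfl | hi0
  · simp only [pow_zero, one_mul] at ht ⊢
    exact mulType_eq_of_units u w fun t x => mul_eq_zero_iff_of_addOrderOf_eq (ht t) x
  · rw [mulType_prime_pow_mul_unit hi0, mulType_prime_pow_mul_unit hi0]

end PrimePower

/-! ### Reduction to prime powers -/

/-- Two maps that identify the same pairs of elements of `S` have images of `S` of equal size. -/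
theorem ncard_image_eq_of_eq_iff {A Y Z : Type*} {S : Set A} {F : A → Y} {H : A → Z}
    (h : ∀ a ∈ S, ∀ b ∈ S, F a = F b ↔ H a = H b) : (F '' S).ncard = (H '' S).ncard := by
  obtain ⟨s, hs, hF⟩ := Set.exists_subset_bijOn S F
  have hH : Set.InjOn H s := fun a ha b hb hab => hF.injOn ha hb ((h a (hs ha) b (hs hb)).2 hab)
  have hHs : H '' s = H '' S := by
    refine Set.Subset.antisymm (Set.image_mono hs) ?_
    rintro _ ⟨a, ha, rfl⟩
    obtain ⟨b, hb, hab⟩ := hF.surjOn (Set.mem_image_of_mem F ha)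
    exact ⟨b, hb, (h b (hs hb) a ha).1 hab⟩
  rw [← hF.image_eq, ← hHs, hF.injOn.ncard_image, hH.ncard_image]

theorem ncard_univ_pi {ι : Type*} [Fintype ι] {Z : ι → Type*} (s : ∀ i, Set (Z i)) :
    (Set.univ.pi s).ncard = ∏ i, (s i).ncard := by
  simp only [← Nat.card_coe_set_eq]
  rw [Nat.card_congr (Equiv.Set.univPi s), Nat.card_pi]

section Product

variable {ι : Type*} [Fintype ι]

theorem card_range_piMap {X : ι → Type*} (f : ∀ i, X i → X i) :
    Nat.card (Set.range (Pi.map f)) = ∏ i, Nat.card (Set.range (f i)) := by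
  rw [Set.range_piMap, Nat.card_coe_set_eq, ncard_univ_pi]
  simp only [Nat.card_coe_set_eq]

theorem card_fixedPoints_iterate_piMap {X : ι → Type*} (f : ∀ i, X i → X i) (t : ℕ) :
    Nat.card {x // (Pi.map f)^[t] x = x} = ∏ i, Nat.card {x // (f i)^[t] x = x} := by
  rw [← Nat.card_pi]
  refine Nat.card_congr (Equiv.trans (Equiv.subtypeEquivRight fun x => ?_)
    Equiv.subtypePiEquivPi)
  rw [Pi.map_iterate, funext_iff]
  rfl

theorem eq_of_prod_eq_of_pairwise_coprime {q c d : ι → ℕ} (hq : Pairwise (Nat.Coprime on q))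
    (hc : ∀ i, c i ∣ q i) (hd : ∀ i, d i ∣ q i) (h : ∏ i, c i = ∏ i, d i) (i : ι) :
    c i = d i := by
  classical
  have key : ∀ {c d : ι → ℕ}, (∀ i, c i ∣ q i) → (∀ i, d i ∣ q i) → ∏ i, c i = ∏ i, d i →
      c i ∣ d i := by
    intro c d hc hd h
    have hdvd : c i ∣ (∏ j ∈ Finset.univ.erase i, d j) * d i := by
      rw [Finset.prod_erase_mul _ _ (Finset.mem_univ i), ← h]
      exact Finset.dvd_prod_of_mem c (Finset.mem_univ i)
    refine Nat.Coprime.dvd_of_dvd_mul_left ?_ hdvd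
    refine Nat.Coprime.prod_right fun j hj => ?_
    exact Nat.Coprime.of_dvd (hc i) (hd j) (hq (Finset.ne_of_mem_erase hj).symm)
  exact Nat.dvd_antisymm (key hc hd h) (key hd hc h.symm)

/-- In a product of rings `ℤ/q_i` with pairwise coprime prime powers `q_i`, the isomorphism type of
a multiplication determines the types of its components: the invariants that classify the
components are pairwise coprime, hence can be read off from their products. -/
theorem mulType_eq_iff_forall {R : Type*} [CommRing R] {q : ι → ℕ}
    (hq : Pairwise (Nat.Coprime on q)) (hpp : ∀ i, ∃ p e, p.Prime ∧ q i = p ^ e)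
    (Φ : R ≃+* ∀ i, ZMod (q i)) (a b : R) :
    mulType a = mulType b ↔ ∀ i, mulType (Φ a i) = mulType (Φ b i) := by
  have hq0 : ∀ i, NeZero (q i) := fun i => by
    obtain ⟨p, e, hp, h⟩ := hpp i
    exact ⟨h ▸ pow_ne_zero e hp.ne_zero⟩
  constructor
  · intro h i
    obtain ⟨σ, hσ⟩ := mulType_eq_iff.1 h
    let τ : (∀ i, ZMod (q i)) ≃ ∀ i, ZMod (q i) :=
      (Φ.symm.toEquiv.trans σ).trans Φ.toEquiv
    have hτ : Semiconj τ (Pi.map fun i => (Φ a i * ·)) (Pi.map fun i => (Φ b i * ·)) := by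
      intro x
      change Φ (σ (Φ.symm (Φ a * x))) = Φ b * Φ (σ (Φ.symm x))
      rw [map_mul, Φ.symm_apply_apply, hσ (Φ.symm x), map_mul]
    have hrange := card_range_eq_of_semiconj τ hτ
    rw [card_range_piMap, card_range_piMap] at hrange
    have h₁ : addOrderOf (Φ a i) = addOrderOf (Φ b i) := by
      rw [← card_range_mul, ← card_range_mul]
      refine eq_of_prod_eq_of_pairwise_coprime hq ?_ ?_ hrange i <;>
      · intro j
        rw [card_range_mul]
        exact (Dvd.intro_left _ (card_mul_eq_zero_mul_addOrderOf _))
    have h₂ : ∀ t : ℕ, addOrderOf (Φ a i ^ t - 1) = addOrderOf (Φ b i ^ t - 1) := by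
      intro t
      have hfix := card_fixedPoints_iterate_eq_of_semiconj τ hτ t
      rw [card_fixedPoints_iterate_piMap, card_fixedPoints_iterate_piMap] at hfix
      refine addOrderOf_pow_sub_one_eq_of_card_eq
        (eq_of_prod_eq_of_pairwise_coprime hq ?_ ?_ hfix i) <;>
      exact fun j => Dvd.intro _ (card_fixedPoints_iterate_mul _ t)
    obtain ⟨p, e, hp, hpe⟩ := hpp i
    have : Fact p.Prime := ⟨hp⟩
    generalize Φ a i = x at h₁ h₂ ⊢
    generalize Φ b i = y at h₁ h₂ ⊢
    revert x y
    rw [hpe]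
    exact fun x y h₁ h₂ => mulType_eq_of_addOrderOf_eq h₁ h₂
  · intro h
    choose σ hσ using fun i => mulType_eq_iff.1 (h i)
    refine mulType_eq_iff.2
      ⟨(Φ.toEquiv.trans (Equiv.piCongrRight σ)).trans Φ.symm.toEquiv, fun x => ?_⟩
    apply Φ.injective
    change Φ (Φ.symm (fun i => σ i (Φ (a * x) i))) =
      Φ (b * Φ.symm (fun i => σ i (Φ x i)))
    rw [map_mul, map_mul, Φ.apply_symm_apply, Φ.apply_symm_apply]
    exact funext fun i => hσ i (Φ x i)

theorem ncard_mulType_image_eq_prod {R : Type*} [CommRing R] {q : ι → ℕ}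
    (hq : Pairwise (Nat.Coprime on q)) (hpp : ∀ i, ∃ p e, p.Prime ∧ q i = p ^ e)
    (Φ : R ≃+* ∀ i, ZMod (q i)) (S : Set R) (T : ∀ i, Set (ZMod (q i)))
    (hST : ∀ a, a ∈ S ↔ ∀ i, Φ a i ∈ T i) :
    (mulType '' S).ncard = ∏ i, (mulType '' T i).ncard := by
  rw [ncard_image_eq_of_eq_iff (H := fun a => Pi.map (fun i => mulType (R := ZMod (q i))) (Φ a)),
    ← ncard_univ_pi, ← Set.piMap_image_univ_pi]
  · congr 1
    have hS : S = Φ ⁻¹' Set.univ.pi T := by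
      ext a
      simp [hST]
    rw [← Set.image_image (Pi.map fun i => mulType (R := ZMod (q i))) Φ, hS,
      Set.image_preimage_eq _ Φ.surjective]
  · intro a _ b _
    rw [mulType_eq_iff_forall hq hpp Φ, funext_iff]
    rfl

end Product

theorem isNilpotent_pi_iff {ι : Type*} [Finite ι] {R : ι → Type*} [∀ i, CommRing (R i)]
    (a : ∀ i, R i) : IsNilpotent a ↔ ∀ i, IsNilpotent (a i) := by
  have := Fintype.ofFinite ι
  constructor
  · rintro ⟨N, hN⟩ i
    exact ⟨N, congrFun hN i⟩
  · intro h
    choose N hN using h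
    exact ⟨∑ i, N i, funext fun i =>
      pow_eq_zero_of_le (Finset.single_le_sum (fun _ _ => Nat.zero_le _) (Finset.mem_univ i))
        (hN i)⟩

/-! ### Counting isomorphism types modulo a prime power -/

theorem ncard_mulType_of_pow_zero {p : ℕ} (S : Set (ZMod (p ^ 0))) (hS : S.Nonempty) :
    (mulType '' S).ncard = 1 := by
  have : Subsingleton (ZMod (p ^ 0)) := by rw [pow_zero]; infer_instance
  rw [Set.Subsingleton.eq_singleton_of_mem (s := S) (fun _ _ _ _ => Subsingleton.elim _ _)
    hS.some_mem, Set.image_singleton, Set.ncard_singleton]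

theorem pow_sub_one_dvd_of_mem_zpowers {R : Type*} [CommRing R] [Finite R] {u w : Rˣ}
    (h : w ∈ Subgroup.zpowers u) (t : ℕ) : (u : R) ^ t - 1 ∣ (w : R) ^ t - 1 := by
  obtain ⟨s, rfl⟩ := mem_powers_iff_mem_zpowers.2 h
  rw [Units.val_pow_eq_pow_val, ← pow_mul, mul_comm, pow_mul]
  simpa using sub_dvd_pow_sub_pow ((u : R) ^ t) 1 s

section PrimePower

variable {p : ℕ} [Fact p.Prime] {e : ℕ}

theorem isUnit_or_isNilpotent (a : ZMod (p ^ e)) : IsUnit a ∨ IsNilpotent a := by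
  obtain ⟨i, -, u, rfl⟩ := exists_eq_prime_pow_mul_unit a
  rcases eq_or_ne i 0 with rfl | hi
  · exact Or.inl (by simp)
  · exact Or.inr (isNilpotent_natCast_pow_mul hi _)

theorem ncard_mulType_isNilpotent (he : e ≠ 0) :
    (mulType '' {a : ZMod (p ^ e) | IsNilpotent a}).ncard = e := by
  have hp : p.Prime := Fact.out
  have : Fact (1 < p ^ e) := ⟨Nat.one_lt_pow he hp.one_lt⟩
  have h : mulType '' {a : ZMod (p ^ e) | IsNilpotent a} =
      (fun i : ℕ => mulType ((p : ZMod (p ^ e)) ^ i)) '' (Finset.Icc 1 e : Finset ℕ) := by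
    ext t
    constructor
    · rintro ⟨a, ha, rfl⟩
      obtain ⟨i, hi, u, rfl⟩ := exists_eq_prime_pow_mul_unit a
      have hi0 : i ≠ 0 := by
        rintro rfl
        exact ha.not_isUnit (by simp)
      exact ⟨i, Finset.mem_coe.2 (Finset.mem_Icc.2 ⟨Nat.pos_of_ne_zero hi0, hi⟩),
        (mulType_prime_pow_mul_unit hi0 u).symm⟩
    · rintro ⟨i, hi, rfl⟩
      have hi' := Finset.mem_Icc.1 (Finset.mem_coe.1 hi)
      refine ⟨_, ?_, rfl⟩
      simpa using isNilpotent_natCast_pow_mul (p := p) (e := e)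
        (Nat.one_le_iff_ne_zero.1 hi'.1) 1
  rw [h, Set.InjOn.ncard_image, Set.ncard_coe_finset, Nat.card_Icc, Nat.add_sub_cancel]
  intro i hi j hj hij
  have hi' := Finset.mem_Icc.1 (Finset.mem_coe.1 hi)
  have hj' := Finset.mem_Icc.1 (Finset.mem_coe.1 hj)
  have h₁ := addOrderOf_eq_of_mulType_eq hij
  have h₂ := fun i => addOrderOf_prime_pow_mul_unit (p := p) (e := e) i 1
  simp only [Units.val_one, mul_one] at h₂
  rw [h₂, h₂] at h₁
  have := Nat.pow_right_injective hp.two_le h₁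
  omega

/-- Multiplications by units and by nilpotent elements have ranges of different sizes, so their
types can be counted separately. -/
theorem ncard_mulType_univ (he : e ≠ 0) :
    (mulType '' (Set.univ : Set (ZMod (p ^ e)))).ncard =
      (mulType '' {a : ZMod (p ^ e) | IsUnit a}).ncard + e := by
  have hp : p.Prime := Fact.out
  have : Fact (1 < p ^ e) := ⟨Nat.one_lt_pow he hp.one_lt⟩
  have huniv : (Set.univ : Set (ZMod (p ^ e))) = {a | IsUnit a} ∪ {a | IsNilpotent a} :=
    (Set.eq_univ_of_forall isUnit_or_isNilpotent).symm
  rw [huniv, Set.image_union, Set.ncard_union_eq ?_ (Set.toFinite _) (Set.toFinite _),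
    ncard_mulType_isNilpotent he]
  rw [Set.disjoint_left]
  rintro _ ⟨_, ⟨u, rfl⟩, rfl⟩ ⟨b, hb, hub⟩
  obtain ⟨i, hi, w, rfl⟩ := exists_eq_prime_pow_mul_unit b
  have h := addOrderOf_eq_of_mulType_eq hub
  have hu := addOrderOf_prime_pow_mul_unit (p := p) 0 u
  rw [pow_zero, one_mul] at hu
  rw [hu, addOrderOf_prime_pow_mul_unit] at h
  have hi0 := Nat.pow_right_injective hp.two_le h
  obtain rfl : i = 0 := by omega
  exact hb.not_isUnit (by simp)

/-- For odd `p` the units modulo `p ^ e` form a cyclic group, and units of the same order generate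
the same subgroup, so that `u ^ t - 1` and `w ^ t - 1` divide each other. Hence the types of units
correspond to the divisors of the order `φ(p ^ e)` of this group. -/
theorem ncard_mulType_isUnit_of_ne_two (hp2 : p ≠ 2) (he : e ≠ 0) :
    (mulType '' {a : ZMod (p ^ e) | IsUnit a}).ncard = e * (p - 1).divisors.card := by
  have hp : p.Prime := Fact.out
  have := ZMod.isCyclic_units_of_prime_pow p hp hp2 e
  have hU : {a : ZMod (p ^ e) | IsUnit a} = Set.range ((↑) : (ZMod (p ^ e))ˣ → ZMod (p ^ e)) := rfl
  rw [hU, ← Set.range_comp, ← Set.image_univ,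
    ncard_image_eq_of_eq_iff (H := fun u : (ZMod (p ^ e))ˣ => orderOf u)]
  · have hdiv : (fun u : (ZMod (p ^ e))ˣ => orderOf u) '' Set.univ =
        ((p ^ e).totient.divisors : Finset ℕ) := by
      have hcard : Nat.card (ZMod (p ^ e))ˣ = (p ^ e).totient := by
        rw [Nat.card_eq_fintype_card, ZMod.card_units_eq_totient]
      ext d
      rw [Finset.mem_coe, Nat.mem_divisors, ← hcard]
      constructor
      · rintro ⟨u, -, rfl⟩
        exact ⟨orderOf_dvd_natCard u, Nat.card_pos.ne'⟩
      · rintro ⟨⟨c, hc⟩, h0⟩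
        obtain ⟨g, hg⟩ := IsCyclic.exists_ofOrder_eq_natCard (α := (ZMod (p ^ e))ˣ)
        have hc0 : c ≠ 0 := by
          rintro rfl
          exact h0 hc
        refine ⟨g ^ c, trivial, ?_⟩
        beta_reduce
        rw [orderOf_pow_of_dvd hc0 (hg ▸ hc ▸ Dvd.intro_left d rfl), hg, hc,
          Nat.mul_div_cancel _ (Nat.pos_of_ne_zero hc0)]
    have hcop : Nat.Coprime (p ^ (e - 1)) (p - 1) :=
      Nat.Coprime.pow_left _ ((Nat.coprime_self_sub_right hp.one_le).2 (Nat.coprime_one_right p))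
    rw [hdiv, Set.ncard_coe_finset, Nat.totient_prime_pow hp (Nat.pos_of_ne_zero he),
      hcop.card_divisors_mul, Nat.divisors_prime_pow hp, Finset.card_map, Finset.card_range,
      Nat.sub_add_cancel (Nat.one_le_iff_ne_zero.2 he)]
  · intro u _ w _
    constructor
    · intro h
      refine orderOf_eq_orderOf_iff.2 fun t => ?_
      have h₁ := addOrderOf_pow_sub_one_eq_of_mulType_eq h t
      rw [Units.ext_iff, Units.ext_iff, Units.val_pow_eq_pow_val, Units.val_pow_eq_pow_val,
        Units.val_one, ← sub_eq_zero, ← sub_eq_zero (a := (w : ZMod (p ^ e)) ^ t),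
        ← AddMonoid.addOrderOf_eq_one_iff, h₁, AddMonoid.addOrderOf_eq_one_iff]
    · intro h
      have hz := zpowers_eq_of_orderOf_eq h
      have key : ∀ {c d : ZMod (p ^ e)} (x), c ∣ d → c * x = 0 → d * x = 0 := by
        rintro c _ x ⟨y, rfl⟩ hc
        rw [mul_right_comm, hc, zero_mul]
      refine mulType_eq_of_units u w fun t x => ⟨key x ?_, key x ?_⟩ <;>
        apply pow_sub_one_dvd_of_mem_zpowers
      · exact hz ▸ Subgroup.mem_zpowers w
      · exact hz ▸ Subgroup.mem_zpowers u

end PrimePower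

/-! ### Units modulo powers of two -/

theorem two_pow_dvd_mul_iff_of_emultiplicity_eq {c d : ℤ}
    (h : emultiplicity 2 c = emultiplicity 2 d) (k : ℕ) (x : ℤ) :
    2 ^ k ∣ c * x ↔ 2 ^ k ∣ d * x := by
  rw [pow_dvd_iff_le_emultiplicity, pow_dvd_iff_le_emultiplicity,
    emultiplicity_mul Int.prime_two, emultiplicity_mul Int.prime_two, h]

theorem exists_odd_intCast_eq {k : ℕ} (hk : k ≠ 0) (u : (ZMod (2 ^ k))ˣ) :
    ∃ c : ℤ, ¬ 2 ∣ c ∧ (u : ZMod (2 ^ k)) = c := by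
  obtain ⟨c, hc⟩ := ZMod.intCast_surjective (u : ZMod (2 ^ k))
  refine ⟨c, ?_, hc.symm⟩
  rintro ⟨d, rfl⟩
  have : Fact (1 < 2 ^ k) := ⟨Nat.one_lt_pow hk one_lt_two⟩
  have h := isNilpotent_natCast_pow_mul (p := 2) (e := k) one_ne_zero (d : ZMod (2 ^ k))
  have hd : ((2 : ℕ) : ZMod (2 ^ k)) ^ 1 * (d : ZMod (2 ^ k)) = u := by
    rw [← hc]; push_cast; ring
  rw [hd] at h
  exact h.not_isUnit u.isUnit

theorem intCast_mul_eq_zero_iff {k : ℕ} (c x : ℤ) :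
    (c : ZMod (2 ^ k)) * (x : ZMod (2 ^ k)) = 0 ↔ 2 ^ k ∣ c * x := by
  rw [← Int.cast_mul, ZMod.intCast_zmod_eq_zero_iff_dvd]
  push_cast
  rfl

theorem unit_pow_odd_sub_one_mul_eq_zero_iff {k : ℕ} (hk : k ≠ 0) (u : (ZMod (2 ^ k))ˣ) {t : ℕ}
    (ht : Odd t) (x : ZMod (2 ^ k)) :
    ((u : ZMod (2 ^ k)) ^ t - 1) * x = 0 ↔ ((u : ZMod (2 ^ k)) - 1) * x = 0 := by
  obtain ⟨c, hc, hu⟩ := exists_odd_intCast_eq hk u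
  obtain ⟨y, rfl⟩ := ZMod.intCast_surjective x
  have h := emultiplicity_pow_sub_pow_of_prime Int.prime_two (x := c) (y := 1) (by omega) hc
    (n := t) (by exact_mod_cast ht.not_two_dvd_nat)
  rw [one_pow] at h
  have key := two_pow_dvd_mul_iff_of_emultiplicity_eq h k y
  rw [← intCast_mul_eq_zero_iff, ← intCast_mul_eq_zero_iff] at key
  rw [hu]
  exact_mod_cast key

/-- By lifting the exponent, `u ^ (2 * m) - 1` has the same `2`-adic valuation as
`(u ^ 2 - 1) * m`. -/
theorem unit_pow_even_sub_one_mul_eq_zero_iff {k : ℕ} (hk : k ≠ 0) (u : (ZMod (2 ^ k))ˣ) (m : ℕ)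
    (x : ZMod (2 ^ k)) :
    ((u : ZMod (2 ^ k)) ^ (2 * m) - 1) * x = 0 ↔ ((u : ZMod (2 ^ k)) ^ 2 - 1) * (m * x) = 0 := by
  obtain ⟨c, hc, hu⟩ := exists_odd_intCast_eq hk u
  obtain ⟨y, rfl⟩ := ZMod.intCast_surjective x
  have h4 : (4 : ℤ) ∣ c ^ 2 - 1 := by
    have := Int.sq_mod_four_eq_one_of_odd (x := c)
      (by rwa [← Int.not_even_iff_odd, even_iff_two_dvd])
    omega
  have h := Int.two_pow_sub_pow' (x := c ^ 2) (y := 1) m h4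
    (fun h => hc (Int.prime_two.dvd_of_dvd_pow h))
  rw [one_pow, ← emultiplicity_mul Int.prime_two, ← pow_mul] at h
  have key := two_pow_dvd_mul_iff_of_emultiplicity_eq h k y
  rw [mul_assoc, ← intCast_mul_eq_zero_iff, ← intCast_mul_eq_zero_iff] at key
  rw [hu]
  push_cast at key
  exact key

/-- Modulo `2 ^ k` the type of a unit `u` is determined by the numbers of fixed points of
multiplication by `u` and by `u ^ 2`. -/
theorem mulType_unit_two_pow_eq_iff {k : ℕ} (hk : k ≠ 0) (u w : (ZMod (2 ^ k))ˣ) :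
    mulType (u : ZMod (2 ^ k)) = mulType (w : ZMod (2 ^ k)) ↔
      addOrderOf ((u : ZMod (2 ^ k)) - 1) = addOrderOf ((w : ZMod (2 ^ k)) - 1) ∧
      addOrderOf ((u : ZMod (2 ^ k)) ^ 2 - 1) = addOrderOf ((w : ZMod (2 ^ k)) ^ 2 - 1) := by
  constructor
  · intro h
    refine ⟨?_, addOrderOf_pow_sub_one_eq_of_mulType_eq h 2⟩
    simpa using addOrderOf_pow_sub_one_eq_of_mulType_eq h 1
  · rintro ⟨h₁, h₂⟩
    refine mulType_eq_of_units u w fun t x => ?_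
    rcases Nat.even_or_odd' t with ⟨m, rfl | rfl⟩
    · rw [unit_pow_even_sub_one_mul_eq_zero_iff hk, unit_pow_even_sub_one_mul_eq_zero_iff hk]
      exact mul_eq_zero_iff_of_addOrderOf_eq h₂ _
    · rw [unit_pow_odd_sub_one_mul_eq_zero_iff hk _ (odd_two_mul_add_one m),
        unit_pow_odd_sub_one_mul_eq_zero_iff hk _ (odd_two_mul_add_one m)]
      exact mul_eq_zero_iff_of_addOrderOf_eq h₁ _

theorem isUnit_add_two_mul {k : ℕ} {u : ZMod (2 ^ k)} (hu : IsUnit u) (x : ZMod (2 ^ k)) :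
    IsUnit (u + 2 * x) := by
  have h := isNilpotent_natCast_pow_mul (p := 2) (e := k) one_ne_zero x
  rw [pow_one, Nat.cast_ofNat] at h
  rw [add_comm]
  exact h.isUnit_add_right_of_commute hu (Commute.all _ _)

theorem addOrderOf_two_pow_mul {k : ℕ} (i : ℕ) {u : ZMod (2 ^ k)} (hu : IsUnit u) :
    addOrderOf (2 ^ i * u) = 2 ^ (k - i) := by
  obtain ⟨u, rfl⟩ := hu
  exact_mod_cast addOrderOf_prime_pow_mul_unit (p := 2) (e := k) i u

/-- For `u = 1 + 2 ^ (i + 2) * w` with a unit `w`, the additive orders of `u - 1` and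
`u ^ 2 - 1`. -/
theorem addOrderOf_one_add {k : ℕ} (i : ℕ) {w : ZMod (2 ^ k)} (hw : IsUnit w) :
    addOrderOf ((1 + 2 ^ (i + 2) * w) - 1) = 2 ^ (k - (i + 2)) ∧
      addOrderOf ((1 + 2 ^ (i + 2) * w) ^ 2 - 1) = 2 ^ (k - (i + 3)) := by
  constructor
  · rw [add_sub_cancel_left, addOrderOf_two_pow_mul _ hw]
  · rw [← addOrderOf_two_pow_mul (i + 3)
      (hw.mul (isUnit_add_two_mul isUnit_one (2 ^ i * w)))]
    congr 1
    ring

/-- For `u = -1 + 2 ^ (i + 2) * w` with a unit `w`, the additive orders of `u - 1` and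
`u ^ 2 - 1`. -/
theorem addOrderOf_neg_one_add {k : ℕ} (i : ℕ) {w : ZMod (2 ^ k)} (hw : IsUnit w) :
    addOrderOf ((-1 + 2 ^ (i + 2) * w) - 1) = 2 ^ (k - 1) ∧
      addOrderOf ((-1 + 2 ^ (i + 2) * w) ^ 2 - 1) = 2 ^ (k - (i + 3)) := by
  constructor
  · rw [← addOrderOf_two_pow_mul 1
      (isUnit_add_two_mul isUnit_one.neg (2 ^ i * w))]
    congr 1
    ring
  · rw [← addOrderOf_two_pow_mul (i + 3)
      (hw.mul (isUnit_add_two_mul isUnit_one.neg (2 ^ i * w)))]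
    congr 1
    ring

/-- A unit modulo `2 ^ k` is `±1` plus a multiple of `4`. If `i + 2 ≥ k`, the multiple
`2 ^ (i + 2) * w` vanishes. -/
theorem exists_unit_two_pow_eq {k : ℕ} (hk : k ≠ 0) (u : (ZMod (2 ^ k))ˣ) :
    ∃ (i : ℕ) (w : ZMod (2 ^ k)), IsUnit w ∧
      ((u : ZMod (2 ^ k)) = 1 + 2 ^ (i + 2) * w ∨ (u : ZMod (2 ^ k)) = -1 + 2 ^ (i + 2) * w) := by
  obtain ⟨c, hc, hu⟩ := exists_odd_intCast_eq hk u
  have h4 : ∃ d, c = 1 + 4 * d ∨ c = -1 + 4 * d := by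
    rcases (by omega : c % 4 = 1 ∨ c % 4 = 3) with h | h
    · exact ⟨c / 4, Or.inl (by omega)⟩
    · exact ⟨c / 4 + 1, Or.inr (by omega)⟩
  obtain ⟨d, hd⟩ := h4
  obtain ⟨i, -, w, hw⟩ := exists_eq_prime_pow_mul_unit (p := 2) (e := k) (d : ZMod (2 ^ k))
  rw [Nat.cast_ofNat] at hw
  refine ⟨i, w, w.isUnit, hd.imp ?_ ?_⟩ <;>
  · intro h
    rw [hu, h]
    push_cast
    rw [hw]
    ring

/-- For `k ≥ 2` the units `1 + 2 ^ r * w` with `2 ≤ r ≤ k` realize `k - 1` types, and the units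
`-1 + 2 ^ s * w` realize `k - 2` further ones (`s = k - 1` and `s = k` give the same type), except
that for `k = 2` the unit `-1` still contributes one. -/
theorem ncard_mulType_isUnit_two_pow {k : ℕ} (hk : 2 ≤ k) :
    (mulType '' {a : ZMod (2 ^ k) | IsUnit a}).ncard = (k - 1) + max 1 (k - 2) := by
  have hk0 : k ≠ 0 := by omega
  have hinj := Nat.pow_right_injective (le_refl 2)
  rw [ncard_image_eq_of_eq_iff (H := fun a => (addOrderOf (a - 1), addOrderOf (a ^ 2 - 1)))]
  · have himage : (fun a : ZMod (2 ^ k) => (addOrderOf (a - 1), addOrderOf (a ^ 2 - 1))) ''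
        {a | IsUnit a} =
        (((Finset.range (k - 1)).image (fun j => (2 ^ j, 2 ^ (j - 1))) ∪
          (Finset.range (max 1 (k - 2))).image (fun j => (2 ^ (k - 1), 2 ^ j)) :
            Finset (ℕ × ℕ)) : Set (ℕ × ℕ)) := by
      ext z
      simp only [Finset.coe_union, Finset.coe_image, Finset.coe_range, Set.mem_union,
        Set.mem_image, Set.mem_Iio]
      constructor
      · rintro ⟨_, ⟨u, rfl⟩, rfl⟩
        obtain ⟨i, w, hw, h | h⟩ := exists_unit_two_pow_eq hk0 u
        · left
          refine ⟨k - (i + 2), by omega, ?_⟩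
          rw [h, (addOrderOf_one_add i hw).1, (addOrderOf_one_add i hw).2]
          rfl
        · right
          refine ⟨k - (i + 3), by omega, ?_⟩
          rw [h, (addOrderOf_neg_one_add i hw).1, (addOrderOf_neg_one_add i hw).2]
      · rintro (⟨j, hj, rfl⟩ | ⟨j, hj, rfl⟩)
        · have h := addOrderOf_one_add (k := k) (k - 2 - j) isUnit_one
          refine ⟨1 + 2 ^ (k - 2 - j + 2) * 1, ?_, ?_⟩
          · rw [pow_succ', mul_assoc]
            exact isUnit_add_two_mul isUnit_one _
          · rw [h.1, h.2, show k - (k - 2 - j + 2) = j by omega,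
              show k - (k - 2 - j + 3) = j - 1 by omega]
        · have h := addOrderOf_neg_one_add (k := k) (k - 3 - j) isUnit_one
          refine ⟨-1 + 2 ^ (k - 3 - j + 2) * 1, ?_, ?_⟩
          · rw [pow_succ', mul_assoc]
            exact isUnit_add_two_mul isUnit_one.neg _
          · rw [h.1, h.2, show k - (k - 3 - j + 3) = j by omega]
    rw [himage, Set.ncard_coe_finset, Finset.card_union_of_disjoint, Finset.card_image_of_injective,
      Finset.card_image_of_injective, Finset.card_range, Finset.card_range]
    · exact fun i j hij => hinj (congrArg Prod.snd hij)
    · exact fun i j hij => hinj (congrArg Prod.fst hij)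
    · rw [Finset.disjoint_left]
      intro z hz hz'
      obtain ⟨i, hi, rfl⟩ := Finset.mem_image.1 hz
      obtain ⟨j, -, hij⟩ := Finset.mem_image.1 hz'
      have h : k - 1 = i := hinj (congrArg Prod.fst hij)
      rw [Finset.mem_range] at hi
      omega
  · rintro _ ⟨u, rfl⟩ _ ⟨w, rfl⟩
    rw [mulType_unit_two_pow_eq_iff hk0, Prod.mk.injEq]

theorem ncard_mulType_isUnit_two_pow_eq_max (k : ℕ) :
    (((mulType '' {a : ZMod (2 ^ k) | IsUnit a}).ncard : ℕ) : ℤ) =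
      max (1 : ℤ) (max (k : ℤ) (2 * (k : ℤ) - 3)) := by
  rcases Nat.lt_or_ge k 2 with hk | hk
  · have h : {a : ZMod (2 ^ k) | IsUnit a} = {1} := by
      ext a
      interval_cases k <;> revert a <;> decide
    rw [h, Set.image_singleton, Set.ncard_singleton]
    omega
  · rw [ncard_mulType_isUnit_two_pow hk]
    omega

/-! ### Assembling the prime powers -/

theorem endStateTypes_zmod (n : ℕ) (P : Digraph (ZMod n) → Prop) :
    endStateTypes (ZMod n) P = mulType '' {a | P (stateSpace (a * ·))} := by
  ext t
  constructor
  · rintro ⟨φ, hP, rfl⟩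
    have h : (φ : ZMod n → ZMod n) = (φ 1 * ·) := by
      funext x
      obtain ⟨k, rfl⟩ := ZMod.intCast_surjective x
      have := map_zsmul φ k 1
      rwa [zsmul_one, zsmul_eq_mul, mul_comm] at this
    rw [h] at hP
    exact ⟨φ 1, hP, congrArg (fun f => isoType (stateSpace f)) h.symm⟩
  · rintro ⟨a, hP, rfl⟩
    exact ⟨AddMonoidHom.mulLeft a, hP, rfl⟩

/-- The numbers of types of all, of the nilpotent and of the unit multiplications modulo `∏ i, q i`
are the products of the corresponding numbers modulo the `q i`. -/
theorem ncard_endStateTypes_prod {ι : Type*} [Fintype ι] (q : ι → ℕ)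
    (hq : Pairwise (Nat.Coprime on q)) (hpp : ∀ i, ∃ p e, p.Prime ∧ q i = p ^ e) :
    (endStateTypes (ZMod (∏ i, q i)) fun _ => True).ncard =
        ∏ i, (mulType '' (Set.univ : Set (ZMod (q i)))).ncard ∧
      (endStateTypes (ZMod (∏ i, q i)) IsOneTree).ncard =
        ∏ i, (mulType '' {a : ZMod (q i) | IsNilpotent a}).ncard ∧
      (endStateTypes (ZMod (∏ i, q i)) IsDisjointUnionOfCycles).ncard =
        ∏ i, (mulType '' {a : ZMod (q i) | IsUnit a}).ncard := by
  have : NeZero (∏ i, q i) := ⟨Finset.prod_ne_zero_iff.2 fun i _ => by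
    obtain ⟨p, e, hp, h⟩ := hpp i
    exact h ▸ pow_ne_zero e hp.ne_zero⟩
  let Φ := ZMod.prodEquivPi q hq
  simp only [endStateTypes_zmod]
  refine ⟨ncard_mulType_image_eq_prod hq hpp Φ _ _ fun a => by simp,
    ncard_mulType_image_eq_prod hq hpp Φ _ _ fun a => ?_,
    ncard_mulType_image_eq_prod hq hpp Φ _ _ fun a => ?_⟩
  · change IsOneTree _ ↔ ∀ i, IsNilpotent (Φ a i)
    rw [isOneTree_mul_iff, ← isNilpotent_pi_iff, IsNilpotent.map_iff Φ.injective]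
  · change IsDisjointUnionOfCycles _ ↔ ∀ i, IsUnit (Φ a i)
    rw [isDisjointUnionOfCycles_mul_iff, ← Pi.isUnit_iff, MulEquiv.isUnit_map]

theorem ncard_mulType_isNilpotent_two_pow (k : ℕ) :
    (((mulType '' {a : ZMod (2 ^ k) | IsNilpotent a}).ncard : ℕ) : ℤ) = max (1 : ℤ) (k : ℤ) := by
  rcases eq_or_ne k 0 with rfl | hk
  · rw [ncard_mulType_of_pow_zero _ ⟨0, IsNilpotent.zero⟩]
    rfl
  · rw [ncard_mulType_isNilpotent hk]
    omega

theorem ncard_mulType_univ_two_pow (k : ℕ) :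
    (((mulType '' (Set.univ : Set (ZMod (2 ^ k)))).ncard : ℕ) : ℤ) =
      max ((2 : ℤ) ^ (k * (if k ≤ 2 then 1 else 0))) (3 * (k : ℤ) - 3) := by
  rcases eq_or_ne k 0 with rfl | hk
  · rw [ncard_mulType_of_pow_zero _ Set.univ_nonempty]
    rfl
  · rw [ncard_mulType_univ hk]
    push_cast
    rw [ncard_mulType_isUnit_two_pow_eq_max]
    rcases Nat.lt_or_ge 2 k with h | h
    · rw [if_neg (by omega), mul_zero, pow_zero]
      omega
    · interval_cases k <;> simp at hk ⊢

end FinDynSys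

theorem theorem5 (n k l : ℕ) (p e : Fin l → ℕ)
    (hp : ∀ i, (p i).Prime) (hp2 : ∀ i, p i ≠ 2) (hinj : Function.Injective p)
    (he : ∀ i, 1 ≤ e i) (hn : n = 2 ^ k * ∏ i, p i ^ e i) :
    ((FinDynSys.endStateTypes (ZMod n) (fun _ => True)).ncard : ℤ) =
        max ((2 : ℤ) ^ (k * (if k ≤ 2 then 1 else 0))) (3 * (k : ℤ) - 3) *
          ∏ i, ((e i : ℤ) * (((p i - 1).divisors.card : ℤ) + 1)) ∧
    ((FinDynSys.endStateTypes (ZMod n) FinDynSys.IsOneTree).ncard : ℤ) =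
        max (1 : ℤ) (k : ℤ) * ∏ i, (e i : ℤ) ∧
    ((FinDynSys.endStateTypes (ZMod n) FinDynSys.IsDisjointUnionOfCycles).ncard : ℤ) =
        max (1 : ℤ) (max (k : ℤ) (2 * (k : ℤ) - 3)) *
          ∏ i, ((e i : ℤ) * ((p i - 1).divisors.card : ℤ)) := by
  let q : Option (Fin l) → ℕ := fun i => i.elim (2 ^ k) fun i => p i ^ e i
  have hq : Pairwise (Function.onFun Nat.Coprime q) := by
    rintro (_ | i) (_ | j) hij
    · exact absurd rfl hij
    · exact Nat.Coprime.pow _ _ ((Nat.coprime_primes Nat.prime_two (hp j)).2 (hp2 j).symm)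
    · exact Nat.Coprime.pow _ _ ((Nat.coprime_primes (hp i) Nat.prime_two).2 (hp2 i))
    · exact Nat.Coprime.pow _ _
        ((Nat.coprime_primes (hp i) (hp j)).2 fun h => hij (congrArg some (hinj h)))
  have hpp : ∀ i, ∃ p e, p.Prime ∧ q i = p ^ e := by
    rintro (_ | i)
    · exact ⟨2, k, Nat.prime_two, rfl⟩
    · exact ⟨p i, e i, hp i, rfl⟩
  have hnq : n = ∏ i, q i := by
    rw [hn, Fintype.prod_option]
    rfl
  obtain ⟨h₁, h₂, h₃⟩ := FinDynSys.ncard_endStateTypes_prod q hq hpp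
  have he0 : ∀ i, e i ≠ 0 := fun i => Nat.one_le_iff_ne_zero.1 (he i)
  rw [hnq, h₁, h₂, h₃, Fintype.prod_option, Fintype.prod_option, Fintype.prod_option]
  simp only [Nat.cast_mul, Nat.cast_prod]
  refine ⟨congrArg₂ _ (FinDynSys.ncard_mulType_univ_two_pow k)
      (Finset.prod_congr rfl fun i _ => ?_),
    congrArg₂ _ (FinDynSys.ncard_mulType_isNilpotent_two_pow k)
      (Finset.prod_congr rfl fun i _ => ?_),
    congrArg₂ _ (FinDynSys.ncard_mulType_isUnit_two_pow_eq_max k)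
      (Finset.prod_congr rfl fun i _ => ?_)⟩ <;>
  have : Fact (p i).Prime := ⟨hp i⟩
  · refine (congrArg Nat.cast (FinDynSys.ncard_mulType_univ (he0 i))).trans ?_
    rw [FinDynSys.ncard_mulType_isUnit_of_ne_two (hp2 i) (he0 i)]
    push_cast
    ring
  · exact congrArg Nat.cast (FinDynSys.ncard_mulType_isNilpotent (he0 i))
  · refine (congrArg Nat.cast
      (FinDynSys.ncard_mulType_isUnit_of_ne_two (hp2 i) (he0 i))).trans ?_
    exact Nat.cast_mul _ _
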